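/- Let $\Omega_n$ denote the set of $n\times n$ complex positive semidefinite matrices of trace one. For $\rho^A,\rho^B\in\Omega_2$ let $\Gamma^Q(\rho^A,\rho^B)$ be the set of all density matrices $\rho^{AB}\in\Omega_4$ on $\mathbb{C}^2\otimes\mathbb{C}^2$ whose partial traces are $\mathrm{tr}_B\,\rho^{AB}=\rho^A$ and $\mathrm{tr}_A\,\rho^{AB}=\rho^B$. Let $C^Q=\frac12(\mathbb{I}-S)$, where $S$ is the SWAP operator $x\otimes y\mapsto y\otimes x$ on $\mathbb{C}^2\otimes\mathbb{C}^2$, and let $$\mathrm{T}^Q_{C^Q}(\rho^A,\rho^B)=\min_{\rho^{AB}\in\Gamma^Q(\rho^A,\rho^B)}\mathrm{tr}\,(C^Q\rho^{AB})$$ be the quantum optimal transport cost. Theorem. For all $\rho^A,\rho^B\in\Omega_2$ (the minimum above and the maximum below being attained), $$\mathrm{T}^Q_{C^Q}(\rho^A,\rho^B)=\frac12\max_{U\in\mathrm{U}(2)}\Big(\sqrt{(U^\dagger\rho^AU)_{11}}-\sqrt{(U^\dagger\rho^BU)_{11}}\Big)^2,$$ where $\mathrm{U}(2)$ is the group of $2\times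 2$ unitary matrices. -/

import Mathlib

namespace QOT

open scoped Matrix ComplexOrder

variable {m n : Type*} [Fintype m] [Fintype n]

/-- Density matrices: positive semidefinite (in particular Hermitian) complex matrices
of trace one. -/
def densityMatrices (n : Type*) [Fintype n] : Set (Matrix n n ℂ) :=
  {ρ | ρ.PosSemidef ∧ ρ.trace = 1}

/-- The partial trace over the first factor, `(tr_A R)_{pq} = ∑ i, R_{(i,p)(i,q)}`. -/
def partialTraceA (R : Matrix (m × n) (m × n) ℂ) : Matrix n n ℂ :=
  Matrix.of fun p q => ∑ i, R (i, p) (i, q)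

/-- The partial trace over the second factor, `(tr_B R)_{ij} = ∑ p, R_{(i,p)(j,p)}`. -/
def partialTraceB (R : Matrix (m × n) (m × n) ℂ) : Matrix m m ℂ :=
  Matrix.of fun i j => ∑ p, R (i, p) (j, p)

/-- Quantum couplings of `ρA` and `ρB`: bipartite density matrices with these marginals. -/
def couplings (ρA : Matrix m m ℂ) (ρB : Matrix n n ℂ) : Set (Matrix (m × n) (m × n) ℂ) :=
  {R | R ∈ densityMatrices (m × n) ∧ partialTraceB R = ρA ∧ partialTraceA R = ρB}

/-- The set of values `tr (C R)` over the couplings `R` of `ρA` and `ρB`. For Hermitian `C` these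
traces are real numbers, so that taking the real part only changes the type. -/
def transportCosts (C : Matrix (m × n) (m × n) ℂ) (ρA : Matrix m m ℂ) (ρB : Matrix n n ℂ) :
    Set ℝ :=
  (fun R => (C * R).trace.re) '' couplings ρA ρB

/-- The quantum optimal transport cost `T^Q_C(ρA, ρB)`, the minimum of the transport costs. -/
noncomputable def transport (C : Matrix (m × n) (m × n) ℂ) (ρA : Matrix m m ℂ)
    (ρB : Matrix n n ℂ) : ℝ :=
  sInf (transportCosts C ρA ρB)

/-- The matrix of the SWAP operator `x ⊗ y ↦ y ⊗ x`. -/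
def swapMatrix (n : Type*) [DecidableEq n] : Matrix (n × n) (n × n) ℂ :=
  Matrix.of fun a b => if a = b.swap then 1 else 0

/-- The cost matrix `C^Q = (I - SWAP) / 2`. -/
noncomputable def costQ (n : Type*) [DecidableEq n] : Matrix (n × n) (n × n) ℂ :=
  (1 / 2 : ℂ) • (1 - swapMatrix n)

/-- The quantity `(√((U† ρA U)₁₁) - √((U† ρB U)₁₁))²` of a unitary matrix `U`; the diagonal
entries of positive semidefinite matrices are non-negative reals. -/
noncomputable def sqrtGap (ρA ρB : Matrix (Fin 2) (Fin 2) ℂ)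
    (U : Matrix.unitaryGroup (Fin 2) ℂ) : ℝ :=
  (√(((U.1ᴴ * ρA * U.1) 0 0).re) - √(((U.1ᴴ * ρB * U.1) 0 0).re)) ^ 2

end QOT

namespace QOT

open scoped Matrix ComplexOrder Kronecker ComplexConjugate

/-! ### Unitary invariance of marginals and costs -/

section Invariance

variable {m n : Type*} [Fintype m] [Fintype n]

/-! The cost commutes with `U ⊗ U`, so conjugating both marginals by `U` leaves the set of transport
costs unchanged, and any given `U` may be rotated to the identity.

Lower bound (`sqrtGap_one_le_of_mem_transportCosts`): with `t, p, q` the populations of `|00⟩, |01⟩,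
|10⟩` in a coupling, positivity of the `|01⟩, |10⟩` minor makes the cost at least `(√p - √q)² / 2`,
and adding `t` under both roots only shrinks the gap.

Attainment: rotate a maximizer of the gap to the identity and let `a, b` be the upper left entries.
If `a ≠ b`, stationarity forces the off-diagonal entries to be `√a z` and `√b z` with the same `z`,
and comparison with one further vector gives `|z|² ≤ 1 - a - b` (`exists_common_factor_of_isMax`).
This is exactly what the explicit coupling of `mem_transportCosts_qubit` needs. If `a = b`, the gap
vanishes identically, the two states coincide, and a coupling of cost zero exists. -/

lemma trace_kronecker_one_mul [DecidableEq n] (X : Matrix m m ℂ) (R : Matrix (m × n) (m × n) ℂ) :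
    ((X ⊗ₖ (1 : Matrix n n ℂ)) * R).trace = (X * partialTraceB R).trace := by
  simp only [Matrix.trace, Matrix.diag, Matrix.mul_apply, Fintype.sum_prod_type, partialTraceB,
    Matrix.kroneckerMap_apply, Matrix.one_apply, Matrix.of_apply, mul_ite, ite_mul, mul_one,
    mul_zero, zero_mul, Finset.sum_ite_eq, Finset.mem_univ, if_true, Finset.mul_sum]
  exact Finset.sum_congr rfl fun i _ => Finset.sum_comm

lemma trace_one_kronecker_mul [DecidableEq m] (X : Matrix n n ℂ) (R : Matrix (m × n) (m × n) ℂ) :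
    (((1 : Matrix m m ℂ) ⊗ₖ X) * R).trace = (X * partialTraceA R).trace := by
  simp only [Matrix.trace, Matrix.diag, Matrix.mul_apply, Fintype.sum_prod_type_right, partialTraceA,
    Matrix.kroneckerMap_apply, Matrix.one_apply, Matrix.of_apply, ite_mul, one_mul,
    zero_mul, Finset.sum_ite_eq, Finset.mem_univ, if_true, Finset.mul_sum]
  exact Finset.sum_congr rfl fun i _ => Finset.sum_comm

lemma trace_mul_conj {k : Type*} [Fintype k] (X V R : Matrix k k ℂ) :
    (X * (Vᴴ * R * V)).trace = (V * X * Vᴴ * R).trace := by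
  rw [← Matrix.mul_assoc, Matrix.trace_mul_comm]
  simp only [Matrix.mul_assoc]

/-- By duality: the partial trace is adjoint to `X ↦ X ⊗ 1` under the trace pairing, and conjugating
`X ⊗ 1` makes the second unitary cancel. -/
lemma partialTraceB_conj [DecidableEq n] (U : Matrix m m ℂ) (V : Matrix.unitaryGroup n ℂ)
    (R : Matrix (m × n) (m × n) ℂ) :
    partialTraceB ((U ⊗ₖ V.1)ᴴ * R * (U ⊗ₖ V.1)) = Uᴴ * partialTraceB R * U := by
  refine Matrix.ext_iff_trace_mul_left.2 fun X => ?_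
  have hV : V.1 * V.1ᴴ = 1 := Matrix.mem_unitaryGroup_iff.1 V.2
  rw [← trace_kronecker_one_mul, trace_mul_conj, trace_mul_conj, ← trace_kronecker_one_mul,
    Matrix.conjTranspose_kronecker, ← Matrix.mul_kronecker_mul, ← Matrix.mul_kronecker_mul,
    Matrix.mul_one, hV]

lemma partialTraceA_conj [DecidableEq m] (U : Matrix.unitaryGroup m ℂ) (V : Matrix n n ℂ)
    (R : Matrix (m × n) (m × n) ℂ) :
    partialTraceA ((U.1 ⊗ₖ V)ᴴ * R * (U.1 ⊗ₖ V)) = Vᴴ * partialTraceA R * V := by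
  refine Matrix.ext_iff_trace_mul_left.2 fun X => ?_
  have hU : U.1 * U.1ᴴ = 1 := Matrix.mem_unitaryGroup_iff.1 U.2
  rw [← trace_one_kronecker_mul, trace_mul_conj, trace_mul_conj, ← trace_one_kronecker_mul,
    Matrix.conjTranspose_kronecker, ← Matrix.mul_kronecker_mul, ← Matrix.mul_kronecker_mul,
    Matrix.mul_one, hU]

variable [DecidableEq n]

lemma kronecker_mul_swapMatrix (U V : Matrix n n ℂ) :
    (U ⊗ₖ V) * swapMatrix n = swapMatrix n * (V ⊗ₖ U) := by
  ext ⟨i, j⟩ ⟨k, l⟩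
  have h1 : ∀ x : n × n, ((i, j) = x.swap) = (x = (j, i)) := fun x => by
    rcases x with ⟨x, y⟩
    simp only [Prod.swap, Prod.mk.injEq, eq_comm, and_comm]
  simp [Matrix.mul_apply, swapMatrix, h1, mul_comm]

lemma kronecker_conj_costQ (U : Matrix.unitaryGroup n ℂ) :
    (U.1 ⊗ₖ U.1) * costQ n * (U.1 ⊗ₖ U.1)ᴴ = costQ n := by
  have hU : U.1 * U.1ᴴ = 1 := Matrix.mem_unitaryGroup_iff.1 U.2
  have h : (U.1 ⊗ₖ U.1) * costQ n = costQ n * (U.1 ⊗ₖ U.1) := by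
    simp [costQ, Matrix.mul_sub, Matrix.sub_mul, kronecker_mul_swapMatrix]
  rw [h, Matrix.mul_assoc, Matrix.conjTranspose_kronecker, ← Matrix.mul_kronecker_mul, hU]
  simp

lemma conj_mem_densityMatrices {ρ : Matrix n n ℂ} (h : ρ ∈ densityMatrices n)
    (U : Matrix.unitaryGroup n ℂ) : U.1ᴴ * ρ * U.1 ∈ densityMatrices n := by
  have hU : U.1 * U.1ᴴ = 1 := Matrix.mem_unitaryGroup_iff.1 U.2
  refine ⟨h.1.conjTranspose_mul_mul_same _, ?_⟩
  rw [Matrix.trace_mul_comm, ← Matrix.mul_assoc, hU, Matrix.one_mul, h.2]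

/-- Simultaneous unitary conjugation of both marginals does not change the transport costs. -/
lemma conj_mem_transportCosts {ρA ρB : Matrix n n ℂ} (U : Matrix.unitaryGroup n ℂ) {c : ℝ}
    (h : c ∈ transportCosts (costQ n) ρA ρB) :
    c ∈ transportCosts (costQ n) (U.1ᴴ * ρA * U.1) (U.1ᴴ * ρB * U.1) := by
  obtain ⟨R, ⟨hR, rfl, rfl⟩, rfl⟩ := h
  let W : Matrix.unitaryGroup (n × n) ℂ :=
    ⟨U.1 ⊗ₖ U.1, Matrix.kronecker_mem_unitary U.2 U.2⟩
  refine ⟨(U.1 ⊗ₖ U.1)ᴴ * R * (U.1 ⊗ₖ U.1),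
    ⟨conj_mem_densityMatrices hR W, partialTraceB_conj _ _ _, partialTraceA_conj _ _ _⟩, ?_⟩
  simp only [trace_mul_conj, kronecker_conj_costQ]

lemma conj_conj_star (U : Matrix.unitaryGroup n ℂ) (ρ : Matrix n n ℂ) :
    (star U).1ᴴ * (U.1ᴴ * ρ * U.1) * (star U).1 = ρ := by
  have hU : U.1 * U.1ᴴ = 1 := Matrix.mem_unitaryGroup_iff.1 U.2
  change U.1ᴴᴴ * (U.1ᴴ * ρ * U.1) * U.1ᴴ = ρ
  rw [Matrix.conjTranspose_conjTranspose, Matrix.mul_assoc, Matrix.mul_assoc, Matrix.mul_assoc,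
    hU, ← Matrix.mul_assoc, hU, Matrix.one_mul, Matrix.mul_one]

lemma mem_transportCosts_of_conj {ρA ρB : Matrix n n ℂ} (U : Matrix.unitaryGroup n ℂ) {c : ℝ}
    (h : c ∈ transportCosts (costQ n) (U.1ᴴ * ρA * U.1) (U.1ᴴ * ρB * U.1)) :
    c ∈ transportCosts (costQ n) ρA ρB := by
  simpa only [conj_conj_star] using conj_mem_transportCosts (star U) h

lemma isCompact_unitaryGroup :
    IsCompact (Matrix.unitaryGroup n ℂ : Set (Matrix n n ℂ)) := by
  refine IsCompact.of_isClosed_subset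
    (isCompact_univ_pi fun _ : n => isCompact_univ_pi fun _ : n =>
      isCompact_closedBall (0 : ℂ) 1) isClosed_unitary fun U hU i _ j _ => ?_
  simpa using entry_norm_bound_of_unitary hU i j

end Invariance

/-! ### The gap as a function of the unitary -/

lemma sqrtGap_mul (ρA ρB : Matrix (Fin 2) (Fin 2) ℂ) (U V : Matrix.unitaryGroup (Fin 2) ℂ) :
    sqrtGap (U.1ᴴ * ρA * U.1) (U.1ᴴ * ρB * U.1) V = sqrtGap ρA ρB (U * V) := by
  simp only [sqrtGap, Submonoid.coe_mul, Matrix.conjTranspose_mul, Matrix.mul_assoc]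

lemma exists_isMaxOn_sqrtGap (ρA ρB : Matrix (Fin 2) (Fin 2) ℂ) :
    ∃ U, ∀ V, sqrtGap ρA ρB V ≤ sqrtGap ρA ρB U := by
  have : CompactSpace (Matrix.unitaryGroup (Fin 2) ℂ) :=
    isCompact_iff_compactSpace.1 isCompact_unitaryGroup
  have hc : Continuous (sqrtGap ρA ρB) := by
    have hA : ∀ ρ : Matrix (Fin 2) (Fin 2) ℂ, Continuous
        fun U : Matrix.unitaryGroup (Fin 2) ℂ => (U.1ᴴ * ρ * U.1) 0 0 := fun ρ =>
      ((((continuous_subtype_val.matrix_conjTranspose).matrix_mul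
        continuous_const).matrix_mul continuous_subtype_val).matrix_elem 0 0)
    unfold sqrtGap
    exact (((Complex.continuous_re.comp (hA ρA)).sqrt).sub
      ((Complex.continuous_re.comp (hA ρB)).sqrt)).pow 2
  obtain ⟨U, -, hU⟩ := isCompact_univ.exists_isMaxOn Set.univ_nonempty hc.continuousOn
  exact ⟨U, fun V => hU (Set.mem_univ V)⟩

/-! ### Qubit states and their quadratic forms -/

/-- The Hermitian `2 × 2` matrix of trace one with upper left entry `a` and upper right entry
`w`. -/
noncomputable def qubit (a : ℝ) (w : ℂ) : Matrix (Fin 2) (Fin 2) ℂ :=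
  !![(a : ℂ), w; conj w, 1 - a]

/-- The quadratic form of `qubit a w`. -/
noncomputable def qubitForm (a : ℝ) (w x y : ℂ) : ℝ :=
  a * Complex.normSq x + (1 - a) * Complex.normSq y + 2 * (conj x * w * y).re

/-- Nonnegativity of the principal minor on the indices `i`, `j`. -/
lemma normSq_entry_le_of_posSemidef {k : Type*} [Fintype k] [DecidableEq k] {M : Matrix k k ℂ}
    (hM : M.PosSemidef) (i j : k) :
    Complex.normSq (M i j) ≤ (M i i).re * (M j j).re := by
  have hd := (hM.submatrix ![i, j]).det_nonneg
  have hji : M j i = conj (M i j) := (hM.1.apply j i).symm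
  have hi := (Complex.nonneg_iff.1 (hM.diag_nonneg (i := i))).2
  have hj := (Complex.nonneg_iff.1 (hM.diag_nonneg (i := j))).2
  rw [Matrix.det_fin_two] at hd
  have := (Complex.nonneg_iff.1 hd).1
  simp only [Matrix.submatrix_apply, Matrix.cons_val_zero, Matrix.cons_val_one,
    hji, Complex.sub_re, Complex.mul_conj, Complex.ofReal_re, Complex.mul_re, ← hi, ← hj] at this
  linarith

lemma exists_eq_qubit {ρ : Matrix (Fin 2) (Fin 2) ℂ} (h : ρ ∈ densityMatrices (Fin 2)) :
    ∃ a w, 0 ≤ a ∧ a ≤ 1 ∧ Complex.normSq w ≤ a * (1 - a) ∧ ρ = qubit a w := by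
  obtain ⟨hp, ht⟩ := h
  have h0 := Complex.nonneg_iff.1 (hp.diag_nonneg (i := 0))
  have h1 := Complex.nonneg_iff.1 (hp.diag_nonneg (i := 1))
  have hn := normSq_entry_le_of_posSemidef hp 0 1
  rw [Matrix.trace_fin_two] at ht
  have ht' : (ρ 0 0).re + (ρ 1 1).re = 1 := by simpa using congrArg Complex.re ht
  have e0 : ((ρ 0 0).re : ℂ) = ρ 0 0 := Complex.ext rfl (by simpa using h0.2)
  refine ⟨(ρ 0 0).re, ρ 0 1, h0.1, by linarith [h1.1], ?_, ?_⟩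
  · rwa [show 1 - (ρ 0 0).re = (ρ 1 1).re by linarith]
  · ext i j
    fin_cases i <;> fin_cases j
    · simp [qubit, e0]
    · simp [qubit]
    · simpa [qubit] using (hp.1.apply 1 0).symm
    · simp only [qubit, e0]
      simpa using eq_sub_of_add_eq' ht

lemma qubitForm_nonneg {a : ℝ} {w : ℂ} (ha : 0 ≤ a) (ha1 : a ≤ 1)
    (hw : Complex.normSq w ≤ a * (1 - a)) (x y : ℂ) : 0 ≤ qubitForm a w x y := by
  have h : |(conj x * w * y).re| ≤ ‖x‖ * ‖w‖ * ‖y‖ := by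
    simpa using Complex.abs_re_le_norm (conj x * w * y)
  have hw' : ‖w‖ ≤ √a * √(1 - a) := by
    rw [← Real.sqrt_mul ha]
    apply Real.le_sqrt_of_sq_le
    rwa [← Complex.normSq_eq_norm_sq]
  have h2 : ‖x‖ * ‖w‖ * ‖y‖ ≤ ‖x‖ * (√a * √(1 - a)) * ‖y‖ := by gcongr
  have h3 := neg_abs_le (conj x * w * y).re
  have h4 := sq_nonneg (√a * ‖x‖ - √(1 - a) * ‖y‖)
  have e1 := Real.sq_sqrt ha
  have e2 := Real.sq_sqrt (sub_nonneg.2 ha1)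
  have h5 : (√a * ‖x‖ - √(1 - a) * ‖y‖) ^ 2 =
      a * ‖x‖ ^ 2 + (1 - a) * ‖y‖ ^ 2 - 2 * (‖x‖ * (√a * √(1 - a)) * ‖y‖) := by
    linear_combination ‖x‖ ^ 2 * e1 + ‖y‖ ^ 2 * e2
  unfold qubitForm
  rw [Complex.normSq_eq_norm_sq, Complex.normSq_eq_norm_sq]
  linarith

/-- A unitary matrix whose first column is a multiple of `(x, y)`. -/
lemma exists_unitary_conj_qubit (x y : ℂ) (h : 0 < Complex.normSq x + Complex.normSq y) :
    ∃ U : Matrix.unitaryGroup (Fin 2) ℂ, ∀ a w, ((U.1ᴴ * qubit a w * U.1) 0 0).re =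
      qubitForm a w x y / (Complex.normSq x + Complex.normSq y) := by
  set N := Complex.normSq x + Complex.normSq y with hN
  set r : ℝ := (√N)⁻¹ with hr
  have hrr : r * r = N⁻¹ := by rw [hr, ← mul_inv, Real.mul_self_sqrt h.le]
  have hrN : (r : ℂ) * r * (x * conj x + y * conj y) = 1 := by
    rw [Complex.mul_conj, Complex.mul_conj, ← Complex.ofReal_add, ← hN]
    exact_mod_cast (by rw [hrr]; exact inv_mul_cancel₀ h.ne' : r * r * N = 1)
  refine ⟨⟨!![r * x, -(r * conj y); r * y, r * conj x], ?_⟩, fun a w => ?_⟩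
  · rw [Matrix.mem_unitaryGroup_iff]
    ext i j
    fin_cases i <;> fin_cases j <;> simp [Matrix.mul_apply, Fin.sum_univ_two, Matrix.star_apply]
    · linear_combination hrN
    · ring
    · ring
    · linear_combination hrN
  · have : ((!![r * x, -(r * conj y); r * y, r * conj x]ᴴ * qubit a w *
        !![(r : ℂ) * x, -(r * conj y); r * y, r * conj x]) 0 0) = ((r * r : ℝ) : ℂ) *
        (a * (x * conj x) + (1 - a) * (y * conj y) + (conj x * w * y + conj (conj x * w * y))) := by
      simp [Matrix.mul_apply, Fin.sum_univ_two, qubit]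
      ring
    rw [this, Complex.re_ofReal_mul, hrr, Complex.mul_conj, Complex.mul_conj, Complex.add_conj,
      div_eq_inv_mul]
    congr 1
    norm_cast

/-! ### The lower bound -/

lemma trace_costQ_mul (R : Matrix (Fin 2 × Fin 2) (Fin 2 × Fin 2) ℂ) :
    (costQ (Fin 2) * R).trace =
      1 / 2 * (R (0, 1) (0, 1) + R (1, 0) (1, 0) - R (0, 1) (1, 0) - R (1, 0) (0, 1)) := by
  simp [costQ, swapMatrix, Matrix.trace, Matrix.mul_apply, Fintype.sum_prod_type,
    Matrix.sub_apply, Matrix.sub_mul]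
  ring

lemma sq_sqrt_add_sub_sqrt_add_le {p q t : ℝ} (hp : 0 ≤ p) (hq : 0 ≤ q) (ht : 0 ≤ t) :
    (√(t + p) - √(t + q)) ^ 2 ≤ (√p - √q) ^ 2 := by
  have h1 := Real.sq_sqrt (add_nonneg ht hp)
  have h2 := Real.sq_sqrt (add_nonneg ht hq)
  have h3 := Real.sq_sqrt hp
  have h4 := Real.sq_sqrt hq
  -- Cauchy–Schwarz for the vectors `(√t, √p)` and `(√t, √q)`.
  have key : t + √p * √q ≤ √(t + p) * √(t + q) := by
    rw [← Real.sqrt_mul (add_nonneg ht hp)]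
    apply Real.le_sqrt_of_sq_le
    have := mul_nonneg ht (sq_nonneg (√p - √q))
    have e : (t + √p * √q) ^ 2 = t ^ 2 + 2 * t * (√p * √q) + p * q := by
      rw [← h3, ← h4]; simp only [Real.sqrt_sq (Real.sqrt_nonneg _)]; ring
    have e' : t * (√p - √q) ^ 2 = t * (p + q) - 2 * t * (√p * √q) := by
      linear_combination t * h3 + t * h4
    nlinarith
  nlinarith

lemma sqrtGap_one_le_of_mem_transportCosts {ρA ρB : Matrix (Fin 2) (Fin 2) ℂ} {c : ℝ}
    (h : c ∈ transportCosts (costQ (Fin 2)) ρA ρB) : 1 / 2 * sqrtGap ρA ρB 1 ≤ c := by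
  obtain ⟨R, ⟨⟨hR, -⟩, rfl, rfl⟩, rfl⟩ := h
  have h00 := (Complex.nonneg_iff.1 (hR.diag_nonneg (i := (0, 0)))).1
  have h01 := (Complex.nonneg_iff.1 (hR.diag_nonneg (i := (0, 1)))).1
  have h10 := (Complex.nonneg_iff.1 (hR.diag_nonneg (i := (1, 0)))).1
  have hn := normSq_entry_le_of_posSemidef hR (0, 1) (1, 0)
  have hc : R (1, 0) (0, 1) = conj (R (0, 1) (1, 0)) := (hR.1.apply _ _).symm
  have hre : (R (0, 1) (1, 0)).re ≤ √(R (0, 1) (0, 1)).re * √(R (1, 0) (1, 0)).re := by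
    rw [← Real.sqrt_mul h01]
    refine (Complex.re_le_norm _).trans (Real.le_sqrt_of_sq_le ?_)
    rwa [← Complex.normSq_eq_norm_sq]
  have hg : sqrtGap (partialTraceB R) (partialTraceA R) 1 =
      (√((R (0, 0) (0, 0)).re + (R (0, 1) (0, 1)).re) -
        √((R (0, 0) (0, 0)).re + (R (1, 0) (1, 0)).re)) ^ 2 := by
    simp [sqrtGap, partialTraceA, partialTraceB, Fin.sum_univ_two]
  have ht : (costQ (Fin 2) * R).trace.re = 1 / 2 * ((R (0, 1) (0, 1)).re + (R (1, 0) (1, 0)).re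
      - 2 * (R (0, 1) (1, 0)).re) := by
    rw [trace_costQ_mul, hc, sub_sub, Complex.add_conj,
      show (1 / 2 : ℂ) = ((1 / 2 : ℝ) : ℂ) by norm_num, Complex.re_ofReal_mul]
    simp
  have := sq_sqrt_add_sub_sqrt_add_le h01 h10 h00
  rw [← hg] at this
  have e1 := Real.sq_sqrt h01
  have e2 := Real.sq_sqrt h10
  simp only [ht]
  nlinarith

lemma sqrtGap_le_of_mem_transportCosts {ρA ρB : Matrix (Fin 2) (Fin 2) ℂ} {c : ℝ}
    (h : c ∈ transportCosts (costQ (Fin 2)) ρA ρB) (U : Matrix.unitaryGroup (Fin 2) ℂ) :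
    1 / 2 * sqrtGap ρA ρB U ≤ c := by
  have := sqrtGap_one_le_of_mem_transportCosts (conj_mem_transportCosts U h)
  rwa [sqrtGap_mul, mul_one] at this

/-! ### Couplings that attain the bound -/

/-- The coupling `|ψ⟩⟨ψ| + κ |11⟩⟨11|` with `ψ = √a |01⟩ + √b |10⟩ + z̄ |11⟩`. -/
lemma mem_transportCosts_qubit {a b : ℝ} {z : ℂ} (ha : 0 ≤ a) (hb : 0 ≤ b)
    (hz : Complex.normSq z ≤ 1 - a - b) :
    1 / 2 * (√a - √b) ^ 2 ∈
      transportCosts (costQ (Fin 2)) (qubit a (√a * z)) (qubit b (√b * z)) := by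
  let ψ : Fin 2 × Fin 2 → ℂ := fun p => !![0, (√a : ℂ); (√b : ℂ), conj z] p.1 p.2
  -- The weight on `|11⟩` is what `ψ` lacks for trace one; it is nonnegative exactly by `hz`, and
  -- the cost does not see it.
  let D : Fin 2 × Fin 2 → ℂ := fun p =>
    !![0, 0; 0, ((1 - a - b - Complex.normSq z : ℝ) : ℂ)] p.1 p.2
  have hD : (Matrix.diagonal D).PosSemidef := by
    refine Matrix.PosSemidef.diagonal fun p => ?_
    rcases p with ⟨i, j⟩
    fin_cases i <;> fin_cases j
    iterate 3 exact le_rfl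
    exact Complex.zero_le_real.2 (sub_nonneg.2 hz)
  have ea : (√a : ℂ) * √a = a := by exact_mod_cast Real.mul_self_sqrt ha
  have eb : (√b : ℂ) * √b = b := by exact_mod_cast Real.mul_self_sqrt hb
  have ez := Complex.mul_conj z
  refine ⟨Matrix.vecMulVec ψ (star ψ) + Matrix.diagonal D,
    ⟨⟨(Matrix.posSemidef_vecMulVec_self_star ψ).add hD, ?_⟩, ?_, ?_⟩, ?_⟩
  · simp [Matrix.trace, Fintype.sum_prod_type, Matrix.vecMulVec_apply, ψ, D]
    linear_combination ea + eb + ez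
  · ext i j
    fin_cases i <;> fin_cases j <;>
      simp [partialTraceB, qubit, Matrix.vecMulVec_apply, Matrix.diagonal_apply, ψ, D]
    · linear_combination ea
    · ring
    · linear_combination eb + ez
  · ext i j
    fin_cases i <;> fin_cases j <;>
      simp [partialTraceA, qubit, Matrix.vecMulVec_apply, Matrix.diagonal_apply, ψ, D]
    · linear_combination eb
    · ring
    · linear_combination ea + ez
  · simp only [trace_costQ_mul]
    simp [Matrix.vecMulVec_apply, ψ, D]
    ring

/-- In an eigenbasis, the classical diagonal coupling `∑ λᵢ |ii⟩⟨ii|` lives on swap-invariant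
vectors, where the cost vanishes. -/
lemma zero_mem_transportCosts_self {ρ : Matrix (Fin 2) (Fin 2) ℂ}
    (h : ρ ∈ densityMatrices (Fin 2)) : 0 ∈ transportCosts (costQ (Fin 2)) ρ ρ := by
  have hH := h.1.1
  apply mem_transportCosts_of_conj hH.eigenvectorUnitary
  have hd := conj_mem_densityMatrices h hH.eigenvectorUnitary
  have hdiag : hH.eigenvectorUnitary.1ᴴ * ρ * hH.eigenvectorUnitary.1 =
      Matrix.diagonal (RCLike.ofReal ∘ hH.eigenvalues) := by
    rw [← hH.conjStarAlgAut_star_eigenvectorUnitary]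
    simp [Unitary.conjStarAlgAut_apply, Matrix.star_eq_conjTranspose]
  rw [hdiag] at hd ⊢
  set D : Fin 2 → ℂ := RCLike.ofReal ∘ hH.eigenvalues
  let E : Fin 2 × Fin 2 → ℂ := fun p => if p.1 = p.2 then D p.1 else 0
  have ht := hd.2
  refine ⟨Matrix.diagonal E, ⟨⟨Matrix.PosSemidef.diagonal fun p => ?_, ?_⟩, ?_, ?_⟩, ?_⟩
  · have := Matrix.posSemidef_diagonal_iff.1 hd.1 p.1
    simp only [E, Pi.zero_apply]
    split_ifs <;> simp [this]
  · simpa [Matrix.trace, Fintype.sum_prod_type, E] using ht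
  · ext i j
    fin_cases i <;> fin_cases j <;> simp [partialTraceB, Matrix.diagonal_apply, E]
  · ext i j
    fin_cases i <;> fin_cases j <;> simp [partialTraceA, Matrix.diagonal_apply, E]
  · simp only [trace_costQ_mul]
    simp [E]

/-! ### Necessary conditions at a maximizer -/

/-- Equality holds at `s = 0`, so left minus right has a maximum there and its derivative `p / √a -
q / √b` vanishes. -/
lemma div_sqrt_eq_of_sqrt_sub_sqrt_le {a b A B p q : ℝ} (ha : 0 < a) (hb : 0 < b)
    (h : ∀ s : ℝ, √(a + A * s ^ 2 + 2 * p * s) - √(b + B * s ^ 2 + 2 * q * s) ≤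
      (√a - √b) * √(1 + s ^ 2)) : p / √a = q / √b := by
  have hd : ∀ x X y : ℝ, 0 < x →
      HasDerivAt (fun s : ℝ => √(x + X * s ^ 2 + 2 * y * s)) (y / √x) 0 := fun x X y hx => by
    have h1 : HasDerivAt (fun s : ℝ => x + X * s ^ 2 + 2 * y * s)
        (0 + X * (2 * 0 ^ (2 - 1) * 1) + 2 * y * 1) 0 :=
      (((hasDerivAt_const (0 : ℝ) x).add (((hasDerivAt_id (0 : ℝ)).pow 2).const_mul X))).add
        ((hasDerivAt_id (0 : ℝ)).const_mul (2 * y))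
    have h2 := h1.sqrt (by simpa using hx.ne')
    convert h2 using 1
    have : √x ≠ 0 := (Real.sqrt_pos.2 hx).ne'
    simp
    field_simp
  -- `√(1 + s²)` is the case `x = X = 1`, `y = 0` of `hd`, with derivative zero at the origin.
  have hg := ((hd a A p ha).sub (hd b B q hb)).sub ((hd 1 1 0 one_pos).const_mul (√a - √b))
  have hmax : IsLocalMax ((fun s : ℝ => √(a + A * s ^ 2 + 2 * p * s)) -
      (fun s : ℝ => √(b + B * s ^ 2 + 2 * q * s)) -
      fun s : ℝ => (√a - √b) * √(1 + 1 * s ^ 2 + 2 * 0 * s)) 0 :=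
    Filter.Eventually.of_forall fun s => by
      have := h s
      simp only [Pi.sub_apply]
      simp
      linarith
  have := hmax.hasDerivAt_eq_zero hg
  simp only [zero_div, mul_zero, sub_zero] at this
  linarith

/-- If `r > 1 - a - b`, the two radicands drop strictly below `b K` and `a K`, where `K = r + (√a +
√b)²`, while their difference remains `(a - b) K`. Smaller roots with the same difference of squares
must lie further apart, against `h`. -/
lemma le_of_sqrt_sub_sqrt_le {a b r : ℝ} (hb : 0 < b) (hab : b < a) (hr : 0 ≤ r)
    (hra : r ≤ 1 - a)
    (h : (√((1 - a - r) * (√a + √b) ^ 2 + r * b) - √((1 - b - r) * (√a + √b) ^ 2 + r * a)) ^ 2 ≤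
      (√a - √b) ^ 2 * (r + (√a + √b) ^ 2)) : r ≤ 1 - a - b := by
  by_contra! hlt
  set M := (√a + √b) ^ 2
  have hM : 0 < M := pow_pos (add_pos (Real.sqrt_pos.2 (hb.trans hab)) (Real.sqrt_pos.2 hb)) 2
  have hα0 : 0 ≤ (1 - a - r) * M + r * b := by
    have : 0 ≤ 1 - a - r := by linarith
    positivity
  have hβ0 : 0 ≤ (1 - b - r) * M + r * a := by
    have : 0 ≤ 1 - b - r := by linarith
    have : 0 < a := hb.trans hab
    positivity
  set K := r + M with hK
  have hK0 : 0 < K := by positivity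
  have hδ : 0 < (r - (1 - a - b)) * M := mul_pos (by linarith) hM
  have hα : √((1 - a - r) * M + r * b) < √(b * K) :=
    Real.sqrt_lt_sqrt hα0 (by rw [hK]; linarith)
  have hβ : √((1 - b - r) * M + r * a) < √(a * K) :=
    Real.sqrt_lt_sqrt hβ0 (by rw [hK]; linarith)
  have hlt2 : √(b * K) < √(a * K) :=
    Real.sqrt_lt_sqrt (by positivity) (mul_lt_mul_of_pos_right hab hK0)
  have eα := Real.sq_sqrt hα0
  have eβ := Real.sq_sqrt hβ0
  have ea : √(a * K) ^ 2 = a * K := Real.sq_sqrt (mul_pos (hb.trans hab) hK0).le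
  have eb : √(b * K) ^ 2 = b * K := Real.sq_sqrt (mul_pos hb hK0).le
  have er : (√a - √b) ^ 2 * K = (√(a * K) - √(b * K)) ^ 2 := by
    rw [Real.sqrt_mul (hb.trans hab).le, Real.sqrt_mul hb.le]
    linear_combination -(√a - √b) ^ 2 * Real.sq_sqrt hK0.le
  rw [er] at h
  have hα' := Real.sqrt_nonneg ((1 - a - r) * M + r * b)
  set α := √((1 - a - r) * M + r * b)
  set β := √((1 - b - r) * M + r * a)
  have hprod : (β - α) * (β + α) = (√(a * K) - √(b * K)) * (√(a * K) + √(b * K)) := by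
    rw [hK] at ea eb ⊢
    linear_combination eβ - eα - ea + eb
  have hd := abs_le_of_sq_le_sq h (sub_nonneg.2 hlt2.le)
  have hd' : β - α ≤ √(a * K) - √(b * K) := by linarith [(abs_le.1 hd).1]
  have : (β - α) * (β + α) < (√(a * K) - √(b * K)) * (√(a * K) + √(b * K)) :=
    mul_lt_mul' hd' (by linarith) (add_nonneg (Real.sqrt_nonneg _) hα') (sub_pos.2 hlt2)
  linarith

/-- If `√⟨x, ρA x⟩ - √⟨x, ρB x⟩` has its largest absolute value on the unit sphere, a non-zero one,
at the first basis vector, then the off-diagonal entries are proportional to the square roots of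
the upper left entries, with a small factor of proportionality. -/
lemma exists_common_factor_of_isMax {a b : ℝ} {w v : ℂ} (ha : 0 ≤ a)
    (hw : Complex.normSq w ≤ a * (1 - a)) (hb : 0 ≤ b)
    (hv : Complex.normSq v ≤ b * (1 - b)) (hab : a ≠ b)
    (h : ∀ x y : ℂ, (√(qubitForm a w x y) - √(qubitForm b v x y)) ^ 2 ≤
      (√a - √b) ^ 2 * (Complex.normSq x + Complex.normSq y)) :
    ∃ z : ℂ, w = √a * z ∧ v = √b * z ∧ Complex.normSq z ≤ 1 - a - b := by
  wlog hlt : b < a generalizing a b w v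
  · obtain ⟨z, h1, h2, h3⟩ := this hb hv ha hw hab.symm
      (fun x y => by rw [sub_sq_comm, sub_sq_comm (√b)]; exact h x y)
      (lt_of_le_of_ne (not_lt.1 hlt) hab)
    exact ⟨z, h2, h1, by linarith⟩
  have ha' : 0 < a := hb.trans_lt hlt
  have hsa : 0 < √a := Real.sqrt_pos.2 ha'
  have hwz : w = √a * (w / √a) := by
    rw [mul_div_cancel₀]
    exact_mod_cast hsa.ne'
  have hza : Complex.normSq (w / √a) ≤ 1 - a := by
    rw [Complex.normSq_div, Complex.normSq_ofReal, Real.mul_self_sqrt ha, div_le_iff₀ ha']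
    linarith
  -- At `b = 0` the square root is not differentiable, but then `v = 0` and the bound on `w` alone
  -- suffices.
  rcases hb.eq_or_lt with rfl | hb'
  · refine ⟨w / √a, hwz, ?_, by linarith⟩
    have : v = 0 := Complex.normSq_eq_zero.1 (le_antisymm (by simpa using hv)
      (Complex.normSq_nonneg _))
    simp [this]
  have hsb : 0 < √b := Real.sqrt_pos.2 hb'
  have hsab : √b < √a := Real.sqrt_lt_sqrt hb hlt
  -- First-order condition along the curve `(1, s u)`; the directions `u = 1` and `u = I` then give
  -- the real and imaginary parts of `v = √b z`.
  have hstat : ∀ u : ℂ, Complex.normSq u = 1 → (w * u).re / √a = (v * u).re / √b := by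
    intro u hu
    apply div_sqrt_eq_of_sqrt_sub_sqrt_le (A := 1 - a) (B := 1 - b) ha' hb'
    intro s
    have hs := h 1 (s * u)
    have e : ∀ (c : ℝ) (t : ℂ), qubitForm c t 1 (s * u) =
        c + (1 - c) * s ^ 2 + 2 * (t * u).re * s := fun c t => by
      rw [qubitForm, map_one, map_one, one_mul, mul_left_comm, Complex.re_ofReal_mul, map_mul, hu,
        Complex.normSq_ofReal]
      ring
    rw [e, e, map_one, map_mul, hu, Complex.normSq_ofReal, mul_one, ← sq] at hs
    have h0 : (0 : ℝ) ≤ 1 + s ^ 2 := by positivity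
    rw [← Real.sq_sqrt h0, ← mul_pow] at hs
    exact (abs_le.1 (abs_le_of_sq_le_sq hs
      (mul_nonneg (sub_nonneg.2 hsab.le) (Real.sqrt_nonneg _)))).2
  have hvz : v = √b * (w / √a) := by
    have h1 := hstat 1 (by simp)
    have h2 := hstat Complex.I (by simp)
    simp only [mul_one, Complex.mul_I_re, neg_div, neg_inj] at h1 h2
    apply Complex.ext
    · rw [Complex.re_ofReal_mul, Complex.div_ofReal_re, h1, mul_div_cancel₀ _ hsb.ne']
    · rw [Complex.im_ofReal_mul, Complex.div_ofReal_im, h2, mul_div_cancel₀ _ hsb.ne']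
  generalize w / (√a : ℂ) = z at *
  refine ⟨z, hwz, hvz, le_of_sqrt_sub_sqrt_le hb' hlt (Complex.normSq_nonneg z) hza ?_⟩
  -- In the boundary case `|z|² = 1 - a - b`, this vector, once normalized, gives the two forms the
  -- values `b` and `a`: the roles are swapped and the gap is again maximal. Beyond the boundary the
  -- gap would be exceeded.
  have hz := h (-z) ((√a + √b : ℝ) : ℂ)
  have e : ∀ c d : ℝ, 0 ≤ c → 0 ≤ d → qubitForm c (√c * z) (-z) ((√c + √d : ℝ) : ℂ) =
      (1 - c - Complex.normSq z) * (√c + √d) ^ 2 + Complex.normSq z * d := by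
    intro c d hc hd
    have : conj (-z) * (√c * z) * ((√c + √d : ℝ) : ℂ) =
        ((-(Complex.normSq z * √c * (√c + √d)) : ℝ) : ℂ) := by
      rw [map_neg]
      push_cast
      rw [← Complex.mul_conj]
      ring
    rw [qubitForm, this, Complex.ofReal_re, Complex.normSq_neg, Complex.normSq_ofReal]
    linear_combination Complex.normSq z * Real.sq_sqrt hd - Complex.normSq z * Real.sq_sqrt hc
  have e1 := e a b ha hb
  have e2 := e b a hb ha
  rw [add_comm √b] at e2
  rw [hwz, hvz, e1, e2, Complex.normSq_neg, Complex.normSq_ofReal, ← sq] at hz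
  exact hz

/-! ### Attainment at a maximizing unitary -/

lemma qubit_eq_of_qubitForm_eq {a b : ℝ} {w v : ℂ}
    (h : ∀ x y, qubitForm a w x y = qubitForm b v x y) : qubit a w = qubit b v := by
  have h1 := h 1 0
  have h2 := h 1 1
  have h3 := h 1 Complex.I
  simp only [qubitForm, map_one, map_zero, mul_one, one_mul, mul_zero, Complex.zero_re, add_zero,
    Complex.normSq_I, Complex.mul_I_re] at h1 h2 h3
  obtain rfl := h1
  rw [show w = v from Complex.ext (by linarith) (by linarith)]

lemma sqrtGap_qubit_one (a b : ℝ) (w v : ℂ) :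
    sqrtGap (qubit a w) (qubit b v) 1 = (√a - √b) ^ 2 := by
  simp [sqrtGap, qubit]

/-- If the identity maximizes the gap, then half of the gap is a transport cost. -/
lemma mem_transportCosts_of_isMax_one {ρA ρB : Matrix (Fin 2) (Fin 2) ℂ}
    (hA : ρA ∈ densityMatrices (Fin 2)) (hB : ρB ∈ densityMatrices (Fin 2))
    (h : ∀ U, sqrtGap ρA ρB U ≤ sqrtGap ρA ρB 1) :
    1 / 2 * sqrtGap ρA ρB 1 ∈ transportCosts (costQ (Fin 2)) ρA ρB := by
  obtain ⟨a, w, ha, ha1, hw, rfl⟩ := exists_eq_qubit hA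
  obtain ⟨b, v, hb, hb1, hv, rfl⟩ := exists_eq_qubit hB
  rw [sqrtGap_qubit_one] at h ⊢
  -- Every nonzero vector is a multiple of the first column of a unitary, so maximality over `U(2)`
  -- becomes a homogeneous inequality on `ℂ²`.
  have hform : ∀ x y : ℂ, (√(qubitForm a w x y) - √(qubitForm b v x y)) ^ 2 ≤
      (√a - √b) ^ 2 * (Complex.normSq x + Complex.normSq y) := by
    intro x y
    have h0 : 0 ≤ Complex.normSq x + Complex.normSq y :=
      add_nonneg (Complex.normSq_nonneg x) (Complex.normSq_nonneg y)
    rcases h0.eq_or_lt with h0 | hN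
    · obtain rfl : x = 0 := Complex.normSq_eq_zero.1
        (by linarith [Complex.normSq_nonneg x, Complex.normSq_nonneg y])
      obtain rfl : y = 0 := Complex.normSq_eq_zero.1
        (by linarith [Complex.normSq_nonneg y, Complex.normSq_zero])
      simp [qubitForm]
    · obtain ⟨U, hU⟩ := exists_unitary_conj_qubit x y hN
      have hgap := h U
      rwa [sqrtGap, hU, hU, Real.sqrt_div' _ h0, Real.sqrt_div' _ h0, ← sub_div, div_pow,
        Real.sq_sqrt h0, div_le_iff₀ hN] at hgap
  by_cases hab : a = b
  · subst hab
    -- The maximal gap is zero, so the two quadratic forms agree everywhere.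
    have heq : qubit a w = qubit a v := qubit_eq_of_qubitForm_eq fun x y => by
      have := hform x y
      rw [sub_self, zero_pow two_ne_zero, zero_mul] at this
      exact (Real.sqrt_inj (qubitForm_nonneg ha ha1 hw x y) (qubitForm_nonneg hb hb1 hv x y)).1
        (sub_eq_zero.1 (pow_eq_zero_iff two_ne_zero |>.1 (le_antisymm this (sq_nonneg _))))
    rw [← heq]
    simpa using zero_mem_transportCosts_self hA
  · obtain ⟨z, rfl, rfl, hz⟩ := exists_common_factor_of_isMax ha hw hb hv hab hform
    exact mem_transportCosts_qubit ha hb hz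

end QOT

theorem theorem7p2 (ρA ρB : Matrix (Fin 2) (Fin 2) ℂ)
    (hA : ρA ∈ QOT.densityMatrices (Fin 2)) (hB : ρB ∈ QOT.densityMatrices (Fin 2)) :
    IsLeast (QOT.transportCosts (QOT.costQ (Fin 2)) ρA ρB)
        (QOT.transport (QOT.costQ (Fin 2)) ρA ρB) ∧
      IsGreatest (Set.range (QOT.sqrtGap ρA ρB))
        (⨆ U : Matrix.unitaryGroup (Fin 2) ℂ, QOT.sqrtGap ρA ρB U) ∧
      QOT.transport (QOT.costQ (Fin 2)) ρA ρB =
        1 / 2 * ⨆ U : Matrix.unitaryGroup (Fin 2) ℂ, QOT.sqrtGap ρA ρB U := by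
  obtain ⟨U, hU⟩ := QOT.exists_isMaxOn_sqrtGap ρA ρB
  have hgreatest : IsGreatest (Set.range (QOT.sqrtGap ρA ρB)) (QOT.sqrtGap ρA ρB U) :=
    ⟨⟨U, rfl⟩, by rintro _ ⟨V, rfl⟩; exact hU V⟩
  have hmem : 1 / 2 * QOT.sqrtGap ρA ρB U ∈
      QOT.transportCosts (QOT.costQ (Fin 2)) ρA ρB := by
    apply QOT.mem_transportCosts_of_conj U
    have := QOT.mem_transportCosts_of_isMax_one (QOT.conj_mem_densityMatrices hA U)
      (QOT.conj_mem_densityMatrices hB U)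
      fun V => by rw [QOT.sqrtGap_mul, QOT.sqrtGap_mul, mul_one]; exact hU _
    rwa [QOT.sqrtGap_mul, mul_one] at this
  have hleast : IsLeast (QOT.transportCosts (QOT.costQ (Fin 2)) ρA ρB)
      (1 / 2 * QOT.sqrtGap ρA ρB U) :=
    ⟨hmem, fun c hc => QOT.sqrtGap_le_of_mem_transportCosts hc U⟩
  have hsup : ⨆ V, QOT.sqrtGap ρA ρB V = QOT.sqrtGap ρA ρB U := hgreatest.csSup_eq
  have hinf : QOT.transport (QOT.costQ (Fin 2)) ρA ρB = 1 / 2 * QOT.sqrtGap ρA ρB U :=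
    hleast.csInf_eq
  rw [hsup, hinf]
  exact ⟨hleast, hgreatest, rfl⟩
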